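/- Let $d\in\mathbb{N}$ and let $\{y_i\}_{i\in\mathbb{N}}$ be the points of a stationary Poisson point process of intensity $1$ in $\mathbb{R}^d$, ordered by their Euclidean distance to the origin. Let $\alpha>0$ and put $\delta=d/\alpha$. Let $f_1,f_2,\dots$ be i.i.d. real random variables, independent of $\{y_i\}$, whose common distribution $F$ (the fading distribution) is supported in $[0,\infty)$ and has mean $1$. Put $x_i=\|y_i\|^\alpha$ and $\xi_i=x_i/f_i$ (with $\xi_i=\infty$ if $f_i=0$ and $x_i>0$), and for Borel $B\subset\mathbb{R}^+=[0,\infty)$ let $$\Phi(B)=\#\{i: x_i\in B\},\qquad \Xi(B)=\#\{i:\xi_i\in B\}$$ be the random counting measures of the path loss process without fading and with fading, respectively. If $\delta=1$, then $\Xi(B)$ and $\Phi(B)$ have the same distribution for every Borel set $B\subset\mathbb{R}^+$; moreover, fading is distribution-preserving: $\Xi$ and $\Phi$ have the same law as random counting measures on $\mathbb{R}^+$ (equivalently, $(\Xi(B_1),\dots,\Xi(B_n))$ and $(\Phi(B_1),\dots,\Phi(B_n))$ have the same joint distribution for all $n$ and all Borel sets $B_1,\dots,B_n\subset\mathbb{R}^+$).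 -/

import Mathlib

open MeasureTheory ProbabilityTheory Set
open scoped NNReal ENNReal

namespace FadingNetwork

noncomputable section

/-- The counting measure of a sequence of points: `B ↦ #{i | p i ∈ B}`. -/
def countingMeasure {E : Type*} [MeasurableSpace E] (p : ℕ → E) : Measure E :=
  Measure.sum fun i => Measure.dirac (p i)

/-- The random measure `N` is a Poisson point process with intensity measure `ν`: the number of
points in a set of finite intensity is Poisson distributed with that mean, and the numbers of
points in finitely many pairwise disjoint sets are independent. -/
structure IsPoissonPointProcess {Ω E : Type*} [MeasurableSpace Ω] [MeasurableSpace E]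
    (N : Ω → Measure E) (ν : Measure E) (P : Measure Ω) : Prop where
  hasLaw_apply : ∀ B : Set E, MeasurableSet B → ν B ≠ ∞ →
    HasLaw (fun ω => N ω B)
      ((poissonMeasure (ν B).toNNReal).map (fun n : ℕ => (n : ℝ≥0∞))) P
  iIndepFun_apply : ∀ (n : ℕ) (B : Fin n → Set E), (∀ k, MeasurableSet (B k)) →
    Pairwise (fun j k => Disjoint (B j) (B k)) → iIndepFun (fun k ω => N ω (B k)) P

/-- The sequence `y` lists the points of a stationary Poisson point process of intensity `1` in
`ℝᵈ`, ordered by their distance to the origin. -/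
structure IsNodeProcess {Ω : Type*} [MeasurableSpace Ω] {d : ℕ}
    (y : ℕ → Ω → EuclideanSpace ℝ (Fin d)) (P : Measure Ω) : Prop where
  measurable : ∀ i, Measurable (y i)
  poisson : IsPoissonPointProcess (fun ω => countingMeasure fun i => y i ω) volume P
  ordered : ∀ᵐ ω ∂P, Monotone fun i => ‖y i ω‖

/-- The path loss `‖y‖ ^ α` of a node at `y`, without fading. -/
def pathLoss {d : ℕ} (α : ℝ) (y : EuclideanSpace ℝ (Fin d)) : ℝ≥0∞ :=
  ENNReal.ofReal (‖y‖ ^ α)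

/-- The path loss `‖y‖ ^ α / f` of a node at `y` with fading coefficient `f`; it is infinite
when `f = 0` (and `y ≠ 0`). -/
def fadingPathLoss {d : ℕ} (α : ℝ) (y : EuclideanSpace ℝ (Fin d)) (f : ℝ) : ℝ≥0∞ :=
  pathLoss α y / ENNReal.ofReal f

/-- The counting measure on `[0, ∞)` of a sequence of path losses in `[0, ∞]`: infinite path
losses are not points of the process. -/
def pathLossMeasure (p : ℕ → ℝ≥0∞) : Measure ℝ≥0 :=
  (countingMeasure p).comap (fun b : ℝ≥0 => (b : ℝ≥0∞))

/-- The path loss process without fading, as a random counting measure on `[0, ∞)`. -/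
def PLP {Ω : Type*} {d : ℕ} (α : ℝ) (y : ℕ → Ω → EuclideanSpace ℝ (Fin d)) (ω : Ω) :
    Measure ℝ≥0 :=
  pathLossMeasure fun i => pathLoss α (y i ω)

/-- The path loss process with fading, as a random counting measure on `[0, ∞)`. -/
def PLPF {Ω : Type*} {d : ℕ} (α : ℝ) (y : ℕ → Ω → EuclideanSpace ℝ (Fin d))
    (f : ℕ → Ω → ℝ) (ω : Ω) : Measure ℝ≥0 :=
  pathLossMeasure fun i => fadingPathLoss α (y i ω) (f i ω)

end

end FadingNetwork

/-! Giving the nodes i.i.d. marks and mapping each marked node to its faded path loss yields a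
Poisson process with intensity averaged over `F`. When `α = d`, `‖y‖ ^ d / s = ‖s ^ (-1/d) • y‖ ^
d`, so a mark `s` multiplies the intensity by `s`; averaging gives the factor `∫ s dF = 1`, and the
intensity is unchanged.

This is carried out with Laplace functionals, which determine the law of a random measure
(`identDistrib_of_lintegral_expNeg`). Given the nodes, independence integrates the marks out factor
by factor, leaving a functional of the nodes alone (`lintegral_expNeg_tsum_marked`). The Poisson
formula `lintegral_expNeg_lintegral` then expresses both sides through `∫ 1 - exp (-g)` of the path
loss, and `lintegral_lintegral_comp_fadingPathLoss` equates the two exponents. -/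

namespace FadingNetwork

/-! ### The exponential on `[0, ∞]` and the Poisson law. -/

/-- The function `x ↦ exp (-x)` on `[0, ∞]`. -/
noncomputable def expNeg (x : ℝ≥0∞) : ℝ≥0∞ := (EReal.exp x)⁻¹

@[simp] lemma expNeg_zero : expNeg 0 = 1 := by simp [expNeg]

@[simp] lemma expNeg_top : expNeg ∞ = 0 := by simp [expNeg]

lemma expNeg_add (x y : ℝ≥0∞) : expNeg (x + y) = expNeg x * expNeg y := by
  rw [expNeg, EReal.coe_ennreal_add, EReal.exp_add, ENNReal.mul_inv]
  · rfl
  · left; simp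
  · right; simp

lemma expNeg_le_one (x : ℝ≥0∞) : expNeg x ≤ 1 := by
  rw [expNeg, ENNReal.inv_le_one, EReal.one_le_exp_iff]
  exact EReal.coe_ennreal_nonneg x

lemma expNeg_ne_top (x : ℝ≥0∞) : expNeg x ≠ ∞ := ((expNeg_le_one x).trans_lt (by simp)).ne

lemma continuous_expNeg : Continuous expNeg :=
  (ENNReal.continuous_exp.comp continuous_coe_ennreal_ereal).inv

@[fun_prop] lemma measurable_expNeg : Measurable expNeg := continuous_expNeg.measurable

lemma expNeg_injective : Function.Injective expNeg := fun x y h => by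
  simpa using EReal.exp_strictMono.injective (inv_injective h)

lemma expNeg_antitone : Antitone expNeg := fun x y h => by
  simpa [expNeg] using h

lemma expNeg_ofReal {r : ℝ} (hr : 0 ≤ r) :
    expNeg (ENNReal.ofReal r) = ENNReal.ofReal (Real.exp (-r)) := by
  rw [expNeg, EReal.coe_ennreal_ofReal, max_eq_left hr, EReal.exp_coe,
    ← ENNReal.ofReal_inv_of_pos (Real.exp_pos _), Real.exp_neg]

lemma expNeg_sum {ι : Type*} (s : Finset ι) (x : ι → ℝ≥0∞) :
    expNeg (∑ i ∈ s, x i) = ∏ i ∈ s, expNeg (x i) := by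
  induction s using Finset.cons_induction with
  | empty => simp
  | cons a s ha ih => rw [Finset.sum_cons, Finset.prod_cons, expNeg_add, ih]

lemma expNeg_mul_natCast (x : ℝ≥0∞) (n : ℕ) : expNeg (x * n) = expNeg x ^ n := by
  have := expNeg_sum (Finset.range n) (fun _ => x)
  simpa [mul_comm] using this

/-- The inverse of `expNeg` on `[0, 1]`. -/
noncomputable def negLog (u : ℝ≥0∞) : ℝ≥0∞ := (ENNReal.log u⁻¹).toENNReal

/-- The bound matters: for `u > 1` the logarithm of `u⁻¹` is negative and `toENNReal` truncates it
to `0`. -/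
lemma expNeg_negLog {u : ℝ≥0∞} (hu : u ≤ 1) : expNeg (negLog u) = u := by
  rw [expNeg, negLog, EReal.coe_toENNReal, ENNReal.exp_log, inv_inv]
  rw [← ENNReal.log_one]
  exact ENNReal.log_monotone (ENNReal.one_le_inv.2 hu)

@[fun_prop] lemma measurable_negLog : Measurable negLog := by
  unfold negLog; fun_prop

lemma lintegral_expNeg_poissonMeasure (r : ℝ≥0) (a : ℝ≥0∞) :
    ∫⁻ n : ℕ, expNeg (a * n) ∂poissonMeasure r = expNeg ((1 - expNeg a) * r) := by
  lift expNeg a to ℝ≥0 using expNeg_ne_top a with v hv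
  have hv1 : v ≤ 1 := by exact_mod_cast hv ▸ expNeg_le_one a
  have hsum : HasSum (fun n : ℕ => Real.exp (-r) * ((r * v : ℝ) ^ n / n.factorial))
      (Real.exp (-r) * Real.exp (r * v)) := by
    rw [Real.exp_eq_exp_ℝ]
    exact (NormedSpace.expSeries_div_hasSum_exp (r * v : ℝ)).mul_left _
  rw [lintegral_countable']
  have h1 : ∀ n : ℕ, expNeg (a * n) * poissonMeasure r {n} =
      ENNReal.ofReal (Real.exp (-r) * ((r * v : ℝ) ^ n / n.factorial)) := fun n => by
    rw [expNeg_mul_natCast, poissonMeasure_singleton, ← hv, ← ENNReal.ofReal_coe_nnreal,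
      ← ENNReal.ofReal_pow (by positivity), ← ENNReal.ofReal_mul (by positivity)]
    congr 1
    ring
  simp_rw [h1]
  rw [← ENNReal.ofReal_tsum_of_nonneg (fun n => by positivity) hsum.summable, hsum.tsum_eq,
    ← Real.exp_add, ← ENNReal.coe_one, ← ENNReal.coe_sub, ← ENNReal.coe_mul,
    ← ENNReal.ofReal_coe_nnreal, expNeg_ofReal (by positivity)]
  congr 2
  rw [NNReal.coe_mul, NNReal.coe_sub hv1]
  push_cast
  ring

/-! ### Laplace functionals of Poisson processes. -/

section Laplace

variable {Ω E : Type*} [MeasurableSpace Ω] [MeasurableSpace E]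

namespace IsPoissonPointProcess

variable {N : Ω → Measure E} {ν : Measure E} {P : Measure Ω}

/-- The case `a = 0` is allowed with infinite intensity because the zero level set of a simple
function may be that large. -/
lemma lintegral_expNeg_mul_apply [IsProbabilityMeasure P] (hN : IsPoissonPointProcess N ν P)
    {B : Set E} (hB : MeasurableSet B)
    {a : ℝ≥0∞} (h : a = 0 ∨ ν B ≠ ∞) :
    ∫⁻ ω, expNeg (a * N ω B) ∂P = expNeg ((1 - expNeg a) * ν B) := by
  rcases h with rfl | h
  · simp
  have hl := hN.hasLaw_apply B hB h
  have hm : Measurable fun x : ℝ≥0∞ => expNeg (a * x) := by fun_prop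
  rw [← lintegral_map' (f := fun x => expNeg (a * x)) hm.aemeasurable hl.aemeasurable, hl.map_eq,
    lintegral_map hm (measurable_from_top), lintegral_expNeg_poissonMeasure, ENNReal.coe_toNNReal h]

/-- Level sets are disjoint, so their counts are independent and the expectation of the product
factors. -/
lemma lintegral_expNeg_simpleFunc [IsProbabilityMeasure P] (hN : IsPoissonPointProcess N ν P)
    (hm : Measurable N) (s : SimpleFunc E ℝ≥0∞) (hs : ∀ x, x ≠ 0 → ν (s ⁻¹' {x}) ≠ ∞) :
    ∫⁻ ω, expNeg (∫⁻ x, s x ∂N ω) ∂P = expNeg (∫⁻ x, 1 - expNeg (s x) ∂ν) := by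
  have hr : ∫⁻ x, 1 - expNeg (s x) ∂ν =
      ∑ a : s.range, (1 - expNeg a) * ν (s ⁻¹' {(a : ℝ≥0∞)}) := by
    have : ∫⁻ x, 1 - expNeg (s x) ∂ν = ∫⁻ x, s.map (fun a => 1 - expNeg a) x ∂ν := rfl
    rw [this, SimpleFunc.lintegral_eq_lintegral, SimpleFunc.map_lintegral]
    exact (Finset.sum_coe_sort s.range fun a => (1 - expNeg a) * ν (s ⁻¹' {a})).symm
  have hl : ∀ ω, ∫⁻ x, s x ∂N ω = ∑ a : s.range, a * N ω (s ⁻¹' {(a : ℝ≥0∞)}) := fun ω => by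
    rw [SimpleFunc.lintegral_eq_lintegral, SimpleFunc.lintegral]
    exact (Finset.sum_coe_sort s.range fun a => a * N ω (s ⁻¹' {a})).symm
  have hind : iIndepFun (fun (a : s.range) ω => N ω (s ⁻¹' {(a : ℝ≥0∞)})) P := by
    let e := Fintype.equivFin s.range
    have := hN.iIndepFun_apply _ (fun k => s ⁻¹' {(e.symm k : ℝ≥0∞)})
      (fun k => s.measurableSet_preimage _) (fun j k hjk => by
        refine Disjoint.preimage _ (Set.disjoint_singleton.2 fun h => hjk ?_)
        exact e.symm.injective (Subtype.ext h))
    simpa using this.precomp e.injective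
  have hme : ∀ a : s.range, Measurable fun ω => N ω (s ⁻¹' {(a : ℝ≥0∞)}) := fun a =>
    (Measure.measurable_coe (s.measurableSet_preimage _)).comp hm
  simp_rw [hr, hl, expNeg_sum]
  rw [lintegral_prod_eq_prod_lintegral_of_indepFun Finset.univ
    (fun (a : s.range) ω => expNeg (a * N ω (s ⁻¹' {(a : ℝ≥0∞)})))
    (hind.comp (fun a x => expNeg (a * x)) fun a => by fun_prop)
    fun a => measurable_expNeg.comp ((hme a).const_mul _)]
  refine Finset.prod_congr rfl fun a _ => ?_
  refine hN.lintegral_expNeg_mul_apply (s.measurableSet_preimage _) ?_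
  by_cases h : (a : ℝ≥0∞) = 0
  · exact .inl h
  · exact .inr (hs _ h)

/-- The Laplace functional of a Poisson point process. -/
theorem lintegral_expNeg_lintegral [IsProbabilityMeasure P] [SigmaFinite ν]
    (hN : IsPoissonPointProcess N ν P) (hm : Measurable N) {h : E → ℝ≥0∞} (hh : Measurable h) :
    ∫⁻ ω, expNeg (∫⁻ x, h x ∂N ω) ∂P = expNeg (∫⁻ x, 1 - expNeg (h x) ∂ν) := by
  -- Cutting off to spanning sets gives every nonzero level set finite intensity, and still
  -- increases to `h`.
  let s : ℕ → SimpleFunc E ℝ≥0∞ := fun n => (SimpleFunc.eapprox h n).restrict (spanningSets ν n)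
  have hs_apply : ∀ n x, s n x = (spanningSets ν n).indicator (SimpleFunc.eapprox h n) x :=
    fun n x => SimpleFunc.restrict_apply _ (measurableSet_spanningSets ν n) _
  have hs_mono : ∀ x, Monotone fun n => s n x := fun x m n hmn => by
    simp only [hs_apply]
    exact (Set.indicator_le_indicator (SimpleFunc.monotone_eapprox h hmn x)).trans
      (Set.indicator_le_indicator_of_subset (monotone_spanningSets ν hmn) (by simp) x)
  have hs_lim : ∀ x, Filter.Tendsto (fun n => s n x) Filter.atTop (nhds (h x)) := fun x => by
    have h1 := tendsto_atTop_iSup fun m n (hmn : m ≤ n) => SimpleFunc.monotone_eapprox h hmn x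
    have h2 : ⨆ n, SimpleFunc.eapprox h n x = h x := SimpleFunc.iSup_eapprox_apply hh x
    rw [h2] at h1
    refine h1.congr' ?_
    obtain ⟨n, hn⟩ := mem_iUnion.1 ((iUnion_spanningSets ν).symm ▸ mem_univ x)
    filter_upwards [Filter.eventually_ge_atTop n] with m hnm
    rw [hs_apply, indicator_of_mem (monotone_spanningSets ν hnm hn)]
  have hs_fin : ∀ n x, x ≠ 0 → ν (s n ⁻¹' {x}) ≠ ∞ := fun n x hx => by
    refine (lt_of_le_of_lt (measure_mono fun y hy => ?_) (measure_spanningSets_lt_top ν n)).ne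
    by_contra hyn
    rw [mem_preimage, hs_apply, indicator_of_notMem hyn] at hy
    exact hx hy.symm
  have hL : ∀ ω, Filter.Tendsto (fun n => expNeg (∫⁻ x, s n x ∂N ω)) Filter.atTop
      (nhds (expNeg (∫⁻ x, h x ∂N ω))) := fun ω =>
    (continuous_expNeg.tendsto _).comp <| lintegral_tendsto_of_tendsto_of_monotone
      (fun n => (s n).measurable.aemeasurable) (.of_forall hs_mono) (.of_forall hs_lim)
  have hL' := tendsto_lintegral_of_dominated_convergence (μ := P) (fun _ => 1)
    (fun n => measurable_expNeg.comp ((Measure.measurable_lintegral (s n).measurable).comp hm))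
    (fun n => .of_forall fun ω => expNeg_le_one _) (by simp) (.of_forall hL)
  have hR : Filter.Tendsto (fun n => ∫⁻ x, 1 - expNeg (s n x) ∂ν) Filter.atTop
      (nhds (∫⁻ x, 1 - expNeg (h x) ∂ν)) :=
    lintegral_tendsto_of_tendsto_of_monotone (fun n => by fun_prop)
      (.of_forall fun x m n hmn => tsub_le_tsub_left (expNeg_antitone (hs_mono x hmn)) _)
      (.of_forall fun x => ENNReal.Tendsto.sub tendsto_const_nhds
        ((continuous_expNeg.tendsto _).comp (hs_lim x)) (.inl (by simp)))
  refine tendsto_nhds_unique hL' (((continuous_expNeg.tendsto _).comp hR).congr fun n => ?_)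
  exact (hN.lintegral_expNeg_simpleFunc hm (s n) (hs_fin n)).symm

end IsPoissonPointProcess

/-! ### Uniqueness from Laplace transforms. -/

/-- A finite measure on `[0, ∞]ⁿ` is determined by its Laplace transform. -/
theorem ext_of_lintegral_expNeg {ι : Type*} [Fintype ι] {μ μ' : Measure (ι → ℝ≥0∞)}
    [IsFiniteMeasure μ] [IsFiniteMeasure μ']
    (h : ∀ c : ι → ℕ, ∫⁻ x, expNeg (∑ i, c i * x i) ∂μ = ∫⁻ x, expNeg (∑ i, c i * x i) ∂μ') :
    μ = μ' := by
  -- The functions `exp (-x i)` are continuous on the compact space `[0, ∞]ⁿ` and separate points,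
  -- `∞` included. Their algebra is spanned by the monomials `exp (-∑ c i * x i)`, so natural
  -- exponents suffice.
  let e : ι → BoundedContinuousFunction (ι → ℝ≥0∞) ℝ := fun i =>
    BoundedContinuousFunction.mkOfCompact ⟨fun x => (expNeg (x i)).toReal,
      ENNReal.continuousOn_toReal.comp_continuous (continuous_expNeg.comp (continuous_apply i))
        fun x => expNeg_ne_top _⟩
  let A : StarSubalgebra ℝ (BoundedContinuousFunction (ι → ℝ≥0∞) ℝ) :=
    { Algebra.adjoin ℝ (range e) with
      star_mem' := fun {a} ha => by
        have : star a = a := by ext; simp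
        rwa [this] }
  have hmono : ∀ g ∈ Submonoid.closure (range e), ∃ c : ι → ℕ,
      ∀ x, g x = (expNeg (∑ i, c i * x i)).toReal := fun g hg => by
    classical
    induction hg using Submonoid.closure_induction with
    | mem g hg =>
      obtain ⟨i, rfl⟩ := hg
      exact ⟨Pi.single i 1, fun x => by simp [e, Pi.single_apply]⟩
    | one => exact ⟨0, fun x => by simp⟩
    | mul f g _ _ hf hg =>
      obtain ⟨c, hc⟩ := hf
      obtain ⟨c', hc'⟩ := hg
      refine ⟨c + c', fun x => ?_⟩
      simp [hc, hc', add_mul, Finset.sum_add_distrib, expNeg_add]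
  have hmeas : ∀ c : ι → ℕ, Measurable fun x : ι → ℝ≥0∞ => expNeg (∑ i, c i * x i) :=
    fun c => by fun_prop
  refine ext_of_forall_mem_subalgebra_integral_eq_of_polish (𝕜 := ℝ) (A := A) ?_ ?_
  · intro x y hxy
    obtain ⟨i, hi⟩ := Function.ne_iff.1 hxy
    refine ⟨e i, ⟨e i, ⟨e i, Algebra.subset_adjoin (mem_range_self i), rfl⟩, rfl⟩, fun hh => hi ?_⟩
    exact expNeg_injective ((ENNReal.toReal_eq_toReal_iff' (expNeg_ne_top _)
      (expNeg_ne_top _)).1 hh)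
  · intro g hg
    have hg' : g ∈ Submodule.span ℝ (Submonoid.closure (range e) :
        Set (BoundedContinuousFunction (ι → ℝ≥0∞) ℝ)) := by
      rw [← Algebra.adjoin_eq_span]; exact hg
    clear hg
    induction hg' using Submodule.span_induction with
    | mem g hg =>
      obtain ⟨c, hc⟩ := hmono g hg
      simp_rw [hc]
      rw [integral_toReal (hmeas c).aemeasurable (.of_forall fun x => (expNeg_ne_top _).lt_top),
        integral_toReal (hmeas c).aemeasurable (.of_forall fun x => (expNeg_ne_top _).lt_top), h c]
    | zero => simp
    | add f g hf hg ihf ihg =>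
      simp only [BoundedContinuousFunction.coe_add, Pi.add_apply]
      rw [integral_add (f.integrable _) (g.integrable _),
        integral_add (f.integrable _) (g.integrable _)]
      rw [ihf, ihg]
    | smul a g hg ih =>
      simp only [BoundedContinuousFunction.coe_smul, integral_smul]
      rw [ih]

/-- The law of a random measure is determined by its Laplace functional. -/
theorem identDistrib_of_lintegral_expNeg {P : Measure Ω} [IsProbabilityMeasure P]
    {M N : Ω → Measure E} (hM : Measurable M) (hN : Measurable N)
    (h : ∀ g : E → ℝ≥0∞, Measurable g →
      ∫⁻ ω, expNeg (∫⁻ x, g x ∂M ω) ∂P = ∫⁻ ω, expNeg (∫⁻ x, g x ∂N ω) ∂P) :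
    IdentDistrib M N P P := by
  let T := {B : Set E // MeasurableSet B}
  let ev : Measure E → T → ℝ≥0∞ := fun μ B => μ B
  have hev : Measurable ev := measurable_pi_lambda _ fun B => Measure.measurable_coe B.2
  have hcomap : (inferInstance : MeasurableSpace (Measure E)) ≤
      MeasurableSpace.comap ev inferInstance := by
    refine iSup₂_le fun B hB => ?_
    rintro _ ⟨S, hS, rfl⟩
    exact ⟨(fun x => x ⟨B, hB⟩) ⁻¹' S, measurable_pi_apply _ hS, rfl⟩
  have key : P.map (fun ω => ev (M ω)) = P.map (fun ω => ev (N ω)) := by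
    -- Evaluations generate the σ-algebra on measures, so finite-dimensional laws decide; testing
    -- `h` on `∑ c B * 1_B` yields their Laplace transforms.
    refine (map_eq_iff_forall_finset_map_restrict_eq (X := fun B ω => ev (M ω) B)
      (Y := fun B ω => ev (N ω) B) (hev.comp hM).aemeasurable
      (hev.comp hN).aemeasurable).2 fun I => ?_
    have hr : Measurable (I.restrict : (T → ℝ≥0∞) → I → ℝ≥0∞) := Finset.measurable_restrict I
    have hM' : Measurable fun ω => I.restrict (ev (M ω)) := hr.comp (hev.comp hM)
    have hN' : Measurable fun ω => I.restrict (ev (N ω)) := hr.comp (hev.comp hN)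
    have := Measure.isProbabilityMeasure_map (μ := P) hM'.aemeasurable
    have := Measure.isProbabilityMeasure_map (μ := P) hN'.aemeasurable
    refine ext_of_lintegral_expNeg fun c => ?_
    have hmeas : Measurable fun x : I → ℝ≥0∞ => expNeg (∑ i, c i * x i) := by fun_prop
    have hint : ∀ μ : Measure E, ∫⁻ x, ∑ B : I, c B * (B.1.1 : Set E).indicator 1 x ∂μ =
        ∑ B : I, c B * μ B.1.1 := fun μ => by
      have hi (B : I) : Measurable ((B.1.1 : Set E).indicator (1 : E → ℝ≥0∞)) :=
        measurable_one.indicator B.1.2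
      rw [lintegral_finsetSum _ fun B _ => (hi B).const_mul _]
      refine Finset.sum_congr rfl fun B _ => ?_
      rw [lintegral_const_mul _ (hi B), lintegral_indicator_one B.1.2]
    rw [lintegral_map hmeas hM', lintegral_map hmeas hN']
    have := h (fun x => ∑ B : I, c B * (B.1.1 : Set E).indicator 1 x)
      (Finset.measurable_fun_sum _ fun B _ =>
        (measurable_one.indicator B.1.2).const_mul _)
    simp_rw [hint] at this
    exact this
  refine ⟨hM.aemeasurable, hN.aemeasurable, Measure.ext fun S hS => ?_⟩
  obtain ⟨S', hS', rfl⟩ := hcomap S hS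
  rw [← Measure.map_apply hev hS', ← Measure.map_apply hev hS', Measure.map_map hev hM,
    Measure.map_map hev hN]
  exact congrArg (fun μ => μ S') key

end Laplace

/-! ### Counting measures and independent marks. -/

section Counting

variable {Ω E S : Type*} [MeasurableSpace Ω] [MeasurableSpace E] [MeasurableSpace S]

lemma lintegral_countingMeasure (p : ℕ → E) {h : E → ℝ≥0∞} (hh : Measurable h) :
    ∫⁻ x, h x ∂countingMeasure p = ∑' i, h (p i) := by
  rw [countingMeasure, lintegral_sum_measure]
  exact tsum_congr fun i => lintegral_dirac' _ hh

lemma measurable_countingMeasure {p : ℕ → Ω → E} (hp : ∀ i, Measurable (p i)) :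
    Measurable fun ω => countingMeasure fun i => p i ω := by
  refine Measure.measurable_of_measurable_coe _ fun B hB => ?_
  have h : ∀ ω, (countingMeasure fun i => p i ω) B = ∑' i, B.indicator 1 (p i ω) := fun ω => by
    rw [← lintegral_countingMeasure _ (measurable_one.indicator hB), lintegral_indicator_one hB]
  simp_rw [h]
  exact Measurable.tsum fun i => (measurable_one.indicator hB).comp (hp i)

lemma measurableEmbedding_coe_nnreal : MeasurableEmbedding fun b : ℝ≥0 => (b : ℝ≥0∞) :=
  ENNReal.isOpenEmbedding_coe.measurableEmbedding

lemma measurable_pathLossMeasure {p : ℕ → Ω → ℝ≥0∞} (hp : ∀ i, Measurable (p i)) :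
    Measurable fun ω => pathLossMeasure fun i => p i ω := by
  refine Measure.measurable_of_measurable_coe _ fun B hB => ?_
  simp_rw [pathLossMeasure, measurableEmbedding_coe_nnreal.comap_apply]
  exact (Measure.measurable_coe (measurableEmbedding_coe_nnreal.measurableSet_image.2 hB)).comp
    (measurable_countingMeasure hp)

/-- The extension of a function on `[0, ∞)` by `0` at `∞`. -/
noncomputable def extendTop (g : ℝ≥0 → ℝ≥0∞) (x : ℝ≥0∞) : ℝ≥0∞ :=
  (range fun b : ℝ≥0 => (b : ℝ≥0∞)).indicator (fun x => g x.toNNReal) x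

lemma measurable_extendTop {g : ℝ≥0 → ℝ≥0∞} (hg : Measurable g) : Measurable (extendTop g) :=
  (hg.comp ENNReal.measurable_toNNReal).indicator measurableEmbedding_coe_nnreal.measurableSet_range

@[simp] lemma extendTop_top (g : ℝ≥0 → ℝ≥0∞) : extendTop g ∞ = 0 := by
  simp [extendTop]

lemma lintegral_pathLossMeasure (p : ℕ → ℝ≥0∞) {g : ℝ≥0 → ℝ≥0∞} (hg : Measurable g) :
    ∫⁻ x, g x ∂pathLossMeasure p = ∑' i, extendTop g (p i) := by
  have hm := hg.comp ENNReal.measurable_toNNReal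
  calc ∫⁻ x, g x ∂pathLossMeasure p
      = ∫⁻ x : ℝ≥0, (g ∘ ENNReal.toNNReal) x ∂pathLossMeasure p := by simp
    _ = ∫⁻ x in range fun b : ℝ≥0 => (b : ℝ≥0∞), (g ∘ ENNReal.toNNReal) x ∂countingMeasure p := by
      rw [← measurableEmbedding_coe_nnreal.map_comap, lintegral_map hm (by fun_prop)]
      rfl
    _ = ∫⁻ x, extendTop g x ∂countingMeasure p := by
      rw [← lintegral_indicator measurableEmbedding_coe_nnreal.measurableSet_range]
      rfl
    _ = _ := lintegral_countingMeasure p (measurable_extendTop hg)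

variable {P : Measure Ω} [IsProbabilityMeasure P] {F : Measure S}
  {Y : ℕ → Ω → E} {f : ℕ → Ω → S}

/-- Integrating out independent, identically distributed marks in a finite product. -/
lemma lintegral_prod_marked (hY : ∀ i, Measurable (Y i)) (hf : ∀ i, Measurable (f i))
    (hf_law : ∀ i, HasLaw (f i) F P) (hf_indep : iIndepFun f P)
    (hYf : IndepFun (fun ω i => Y i ω) (fun ω i => f i ω) P)
    {k : E → S → ℝ≥0∞} (hk : Measurable (Function.uncurry k)) (I : Finset ℕ) :
    ∫⁻ ω, ∏ i ∈ I, k (Y i ω) (f i ω) ∂P = ∫⁻ ω, ∏ i ∈ I, ∫⁻ s, k (Y i ω) s ∂F ∂P := by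
  have hY' : Measurable fun ω i => Y i ω := measurable_pi_lambda _ hY
  have hf' : Measurable fun ω i => f i ω := measurable_pi_lambda _ hf
  have hK : Measurable fun q : (ℕ → E) × (ℕ → S) => ∏ i ∈ I, k (q.1 i) (q.2 i) :=
    Finset.measurable_fun_prod _ fun i _ => hk.comp
      (f := fun q : (ℕ → E) × (ℕ → S) => (q.1 i, q.2 i)) (by fun_prop)
  have := Measure.isProbabilityMeasure_map (μ := P) hf'.aemeasurable
  have := Measure.isProbabilityMeasure_map (μ := P) hY'.aemeasurable
  calc ∫⁻ ω, ∏ i ∈ I, k (Y i ω) (f i ω) ∂P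
      = ∫⁻ q, ∏ i ∈ I, k (q.1 i) (q.2 i) ∂P.map fun ω => (fun i => Y i ω, fun i => f i ω) :=
        (lintegral_map hK (hY'.prodMk hf')).symm
    _ = ∫⁻ y, ∫⁻ s, ∏ i ∈ I, k (y i) (s i) ∂P.map (fun ω i => f i ω) ∂P.map fun ω i => Y i ω := by
      rw [(indepFun_iff_map_prod_eq_prod_map_map hY'.aemeasurable hf'.aemeasurable).1 hYf,
        lintegral_prod _ hK.aemeasurable]
    _ = ∫⁻ ω, ∫⁻ s, ∏ i ∈ I, k (Y i ω) (s i) ∂P.map (fun ω i => f i ω) ∂P :=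
      lintegral_map hK.lintegral_prod_right' hY'
    _ = _ := by
      refine lintegral_congr fun ω => ?_
      have hki : ∀ i, Measurable (k (Y i ω)) := fun i => hk.comp measurable_prodMk_left
      rw [lintegral_map (f := fun s : ℕ → S => ∏ i ∈ I, k (Y i ω) (s i))
        (hK.comp measurable_prodMk_left) hf',
        lintegral_prod_eq_prod_lintegral_of_indepFun I (fun i ω' => k (Y i ω) (f i ω'))
          (hf_indep.comp _ hki) fun i => (hki i).comp (hf i)]
      refine Finset.prod_congr rfl fun i _ => ?_
      rw [← (hf_law i).map_eq, lintegral_map (hki i) (hf i)]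

/-- Passes from finitely many points, where marks integrate out of a finite product, to all of them.
-/
lemma tendsto_lintegral_expNeg_sum {a : ℕ → Ω → ℝ≥0∞} (ha : ∀ i, Measurable (a i)) :
    Filter.Tendsto (fun n => ∫⁻ ω, expNeg (∑ i ∈ Finset.range n, a i ω) ∂P) Filter.atTop
      (nhds (∫⁻ ω, expNeg (∑' i, a i ω) ∂P)) :=
  tendsto_lintegral_of_dominated_convergence (fun _ => 1)
    (fun n => measurable_expNeg.comp (Finset.measurable_fun_sum _ fun i _ => ha i))
    (fun n => .of_forall fun ω => expNeg_le_one _) (by simp)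
    (.of_forall fun ω => (continuous_expNeg.tendsto _).comp (ENNReal.tendsto_nat_tsum _))

lemma lintegral_expNeg_le_one [IsProbabilityMeasure F] (h : S → ℝ≥0∞) : ∫⁻ s, expNeg (h s) ∂F ≤ 1 :=
  (lintegral_mono fun s => expNeg_le_one (h s)).trans (by simp)

/-- The Laplace functional of an independently marked point process, in terms of the points. -/
theorem lintegral_expNeg_tsum_marked [IsProbabilityMeasure F] (hY : ∀ i, Measurable (Y i))
    (hf : ∀ i, Measurable (f i)) (hf_law : ∀ i, HasLaw (f i) F P) (hf_indep : iIndepFun f P)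
    (hYf : IndepFun (fun ω i => Y i ω) (fun ω i => f i ω) P)
    {h : E → S → ℝ≥0∞} (hh : Measurable (Function.uncurry h)) :
    ∫⁻ ω, expNeg (∑' i, h (Y i ω) (f i ω)) ∂P =
      ∫⁻ ω, expNeg (∑' i, negLog (∫⁻ s, expNeg (h (Y i ω) s) ∂F)) ∂P := by
  have hk : Measurable (Function.uncurry fun y s => expNeg (h y s)) := measurable_expNeg.comp hh
  have hH : Measurable fun y => negLog (∫⁻ s, expNeg (h y s) ∂F) :=
    measurable_negLog.comp hk.lintegral_prod_right'
  refine tendsto_nhds_unique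
    (tendsto_lintegral_expNeg_sum fun i => hh.comp ((hY i).prodMk (hf i)))
    ((tendsto_lintegral_expNeg_sum fun i => hH.comp (hY i)).congr fun n => ?_)
  simp only [Function.comp_apply, expNeg_sum,
    expNeg_negLog (lintegral_expNeg_le_one _)]
  exact (lintegral_prod_marked hY hf hf_law hf_indep hYf hk _).symm

end Counting

/-! ### Effect of fading on the intensity. -/

section Scaling

variable {d : ℕ}

@[fun_prop] lemma measurable_pathLoss (α : ℝ) :
    Measurable (pathLoss α : EuclideanSpace ℝ (Fin d) → ℝ≥0∞) := by
  unfold pathLoss; fun_prop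

@[fun_prop] lemma _root_.Measurable.fadingPathLoss {Ω : Type*} [MeasurableSpace Ω] (α : ℝ)
    {y : Ω → EuclideanSpace ℝ (Fin d)} {f : Ω → ℝ} (hy : Measurable y) (hf : Measurable f) :
    Measurable fun ω => fadingPathLoss α (y ω) (f ω) := by
  unfold FadingNetwork.fadingPathLoss; fun_prop

lemma measurable_uncurry_fadingPathLoss (α : ℝ) :
    Measurable (Function.uncurry (fadingPathLoss α : EuclideanSpace ℝ (Fin d) → ℝ → ℝ≥0∞)) :=
  measurable_fst.fadingPathLoss α measurable_snd

lemma fadingPathLoss_eq_pathLoss_smul (hd : d ≠ 0) (y : EuclideanSpace ℝ (Fin d)) {s : ℝ}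
    (hs : 0 < s) : fadingPathLoss d y s = pathLoss d (s⁻¹ ^ (d : ℝ)⁻¹ • y) := by
  rw [fadingPathLoss, pathLoss, pathLoss, ← ENNReal.ofReal_div_of_pos hs, norm_smul,
    Real.mul_rpow (norm_nonneg _) (norm_nonneg _), Real.norm_of_nonneg (by positivity),
    Real.rpow_inv_rpow (by positivity) (by positivity), div_eq_inv_mul]

/-- In dimension `d = α`, a fading coefficient `s` scales the mean of the path loss process by
the factor `s`. -/
lemma lintegral_comp_fadingPathLoss (hd : d ≠ 0) {G : ℝ≥0∞ → ℝ≥0∞} (hG : Measurable G)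
    (hG_top : G ∞ = 0) {s : ℝ} (hs : 0 ≤ s) :
    ∫⁻ y : EuclideanSpace ℝ (Fin d), G (fadingPathLoss d y s) =
      ENNReal.ofReal s * ∫⁻ y : EuclideanSpace ℝ (Fin d), G (pathLoss d y) := by
  rcases hs.eq_or_lt with rfl | hs
  -- For `s = 0` every path loss off the origin is infinite, where `G` vanishes; the origin is null
  -- as `d ≠ 0`.
  · have : Nonempty (Fin d) := Fin.pos_iff_nonempty.1 (Nat.pos_of_ne_zero hd)
    have h0 : ∀ᵐ y : EuclideanSpace ℝ (Fin d), y ≠ 0 := by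
      simp [ae_iff]
    rw [ENNReal.ofReal_zero, zero_mul]
    refine (lintegral_congr_ae (h0.mono fun y hy => ?_)).trans lintegral_zero
    have : pathLoss d y ≠ 0 := by
      have : 0 < ‖y‖ := norm_pos_iff.2 hy
      simp only [pathLoss, ne_eq, ENNReal.ofReal_eq_zero, not_le]
      positivity
    simp only [fadingPathLoss, ENNReal.ofReal_zero, ENNReal.div_zero this, hG_top]
  · set r : ℝ := s⁻¹ ^ (d : ℝ)⁻¹ with hr
    have hr0 : 0 < r := by positivity
    have hrd : (r ^ d)⁻¹ = s := by
      rw [hr, ← Real.rpow_natCast, Real.rpow_inv_rpow (by positivity) (by positivity), inv_inv]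
    simp_rw [fadingPathLoss_eq_pathLoss_smul hd _ hs, ← hr]
    rw [← lintegral_map (f := fun y => G (pathLoss d y)) (hG.comp (measurable_pathLoss _))
      (measurable_const_smul r), Measure.map_addHaar_smul _ hr0.ne', lintegral_smul_measure,
      finrank_euclideanSpace_fin, hrd, abs_of_pos hs, smul_eq_mul]

/-- Fading of mean `1` preserves the mean of the path loss process in dimension `d = α`. -/
lemma lintegral_lintegral_comp_fadingPathLoss (hd : d ≠ 0) {F : Measure ℝ} [SFinite F]
    (hF_nonneg : F (Iio 0) = 0) (hF_integrable : Integrable (fun x : ℝ => x) F)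
    (hF_mean : ∫ x, x ∂F = 1) {G : ℝ≥0∞ → ℝ≥0∞} (hG : Measurable G) (hG_top : G ∞ = 0) :
    ∫⁻ y : EuclideanSpace ℝ (Fin d), ∫⁻ s, G (fadingPathLoss d y s) ∂F =
      ∫⁻ y : EuclideanSpace ℝ (Fin d), G (pathLoss d y) := by
  have h0 : ∀ᵐ s ∂F, 0 ≤ s := by
    rw [ae_iff]
    simpa [Iio] using hF_nonneg
  have hm : Measurable (Function.uncurry fun (y : EuclideanSpace ℝ (Fin d)) s =>
      G (fadingPathLoss d y s)) := hG.comp (measurable_uncurry_fadingPathLoss _)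
  rw [lintegral_lintegral_swap hm.aemeasurable,
    lintegral_congr_ae (h0.mono fun s hs => lintegral_comp_fadingPathLoss hd hG hG_top hs),
    lintegral_mul_const _ ENNReal.measurable_ofReal,
    ← ofReal_integral_eq_lintegral_ofReal hF_integrable h0, hF_mean, ENNReal.ofReal_one, one_mul]

end Scaling

/-! ### Laplace functionals of the two path loss processes. -/

section PathLossLaplace

variable {Ω : Type*} [MeasurableSpace Ω] {P : Measure Ω} [IsProbabilityMeasure P] {d : ℕ}
  {y : ℕ → Ω → EuclideanSpace ℝ (Fin d)} {f : ℕ → Ω → ℝ} {F : Measure ℝ}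

/-- The Laplace functional of the path loss process without fading. -/
lemma lintegral_expNeg_lintegral_PLP (α : ℝ) (hy : IsNodeProcess y P) {g : ℝ≥0 → ℝ≥0∞}
    (hg : Measurable g) :
    ∫⁻ ω, expNeg (∫⁻ x, g x ∂PLP α y ω) ∂P =
      expNeg (∫⁻ z : EuclideanSpace ℝ (Fin d), 1 - expNeg (extendTop g (pathLoss α z))) := by
  have hφ : Measurable fun z : EuclideanSpace ℝ (Fin d) => extendTop g (pathLoss α z) :=
    (measurable_extendTop hg).comp (measurable_pathLoss α)
  rw [← hy.poisson.lintegral_expNeg_lintegral (measurable_countingMeasure hy.measurable) hφ]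
  refine lintegral_congr fun ω => ?_
  rw [PLP, lintegral_pathLossMeasure _ hg, lintegral_countingMeasure _ hφ]

/-- The Laplace functional of the path loss process with fading. -/
lemma lintegral_expNeg_lintegral_PLPF [IsProbabilityMeasure F] (α : ℝ) (hy : IsNodeProcess y P)
    (hf : ∀ i, Measurable (f i)) (hf_law : ∀ i, HasLaw (f i) F P) (hf_indep : iIndepFun f P)
    (hyf : IndepFun (fun ω i => y i ω) (fun ω i => f i ω) P) {g : ℝ≥0 → ℝ≥0∞}
    (hg : Measurable g) :
    ∫⁻ ω, expNeg (∫⁻ x, g x ∂PLPF α y f ω) ∂P =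
      expNeg (∫⁻ z : EuclideanSpace ℝ (Fin d), ∫⁻ s,
        1 - expNeg (extendTop g (fadingPathLoss α z s)) ∂F) := by
  have hψ : Measurable (Function.uncurry fun (z : EuclideanSpace ℝ (Fin d)) s =>
      extendTop g (fadingPathLoss α z s)) :=
    (measurable_extendTop hg).comp (measurable_uncurry_fadingPathLoss α)
  have hk : Measurable (Function.uncurry fun (z : EuclideanSpace ℝ (Fin d)) s =>
      expNeg (extendTop g (fadingPathLoss α z s))) := measurable_expNeg.comp hψ
  have hH : Measurable fun z : EuclideanSpace ℝ (Fin d) =>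
      negLog (∫⁻ s, expNeg (extendTop g (fadingPathLoss α z s)) ∂F) :=
    measurable_negLog.comp hk.lintegral_prod_right'
  -- Puts the exponent in the form `1 - exp (-h z)`, so that the Poisson formula for the unmarked
  -- nodes can be read backwards.
  have hone : ∀ z : EuclideanSpace ℝ (Fin d),
      ∫⁻ s, 1 - expNeg (extendTop g (fadingPathLoss α z s)) ∂F =
        1 - expNeg (negLog (∫⁻ s, expNeg (extendTop g (fadingPathLoss α z s)) ∂F)) := fun z => by
    have hkz : Measurable fun s => expNeg (extendTop g (fadingPathLoss α z s)) :=
      measurable_expNeg.comp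
        ((measurable_extendTop hg).comp (measurable_const.fadingPathLoss α measurable_id))
    rw [expNeg_negLog (lintegral_expNeg_le_one _), lintegral_sub hkz
      ((lintegral_expNeg_le_one _).trans_lt ENNReal.one_lt_top).ne
      (.of_forall fun s => expNeg_le_one _), lintegral_one, measure_univ]
  rw [lintegral_congr hone,
    ← hy.poisson.lintegral_expNeg_lintegral (measurable_countingMeasure hy.measurable) hH]
  have h1 : ∀ ω, ∫⁻ x, g x ∂PLPF α y f ω =
      ∑' i, extendTop g (fadingPathLoss α (y i ω) (f i ω)) := fun ω => by
    rw [PLPF, lintegral_pathLossMeasure _ hg]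
  simp_rw [h1, lintegral_countingMeasure _ hH]
  exact lintegral_expNeg_tsum_marked hy.measurable hf hf_law hf_indep hyf hψ

end PathLossLaplace

end FadingNetwork

theorem proposition2 {Ω : Type*} [MeasurableSpace Ω] (P : Measure Ω) [IsProbabilityMeasure P]
    (d : ℕ) (α : ℝ) (hα : 0 < α) (hδ : (d : ℝ) / α = 1)
    (F : Measure ℝ) [IsProbabilityMeasure F] (hF_nonneg : F (Set.Iio 0) = 0)
    (hF_integrable : Integrable (fun x : ℝ => x) F) (hF_mean : ∫ x, x ∂F = 1)
    (y : ℕ → Ω → EuclideanSpace ℝ (Fin d)) (hy : FadingNetwork.IsNodeProcess y P)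
    (f : ℕ → Ω → ℝ) (hf_measurable : ∀ i, Measurable (f i))
    (hf_law : ∀ i, HasLaw (f i) F P) (hf_indep : iIndepFun f P)
    (hyf : IndepFun (fun ω i => y i ω) (fun ω i => f i ω) P) :
    (∀ B : Set ℝ≥0, MeasurableSet B →
      IdentDistrib (fun ω => FadingNetwork.PLPF α y f ω B)
        (fun ω => FadingNetwork.PLP α y ω B) P P) ∧
    IdentDistrib (FadingNetwork.PLPF α y f) (FadingNetwork.PLP α y) P P := by
  obtain rfl : (d : ℝ) = α := (div_eq_one_iff_eq hα.ne').1 hδ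
  have hd : d ≠ 0 := by
    rintro rfl
    simp at hα
  suffices h : IdentDistrib (FadingNetwork.PLPF d y f) (FadingNetwork.PLP d y) P P from
    ⟨fun B hB => h.comp (Measure.measurable_coe hB), h⟩
  have hΞ : ∀ i, Measurable fun ω => FadingNetwork.fadingPathLoss d (y i ω) (f i ω) := fun i =>
    (hy.measurable i).fadingPathLoss d (hf_measurable i)
  have hΦ : ∀ i, Measurable fun ω => FadingNetwork.pathLoss d (y i ω) := fun i =>
    (FadingNetwork.measurable_pathLoss _).comp (hy.measurable i)
  refine FadingNetwork.identDistrib_of_lintegral_expNeg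
    (FadingNetwork.measurable_pathLossMeasure hΞ) (FadingNetwork.measurable_pathLossMeasure hΦ)
    fun g hg => ?_
  -- The `G` below vanishes at `∞` because `extendTop g` does: infinite path losses are not counted.
  rw [FadingNetwork.lintegral_expNeg_lintegral_PLP _ hy hg,
    FadingNetwork.lintegral_expNeg_lintegral_PLPF _ hy hf_measurable hf_law hf_indep hyf hg,
    FadingNetwork.lintegral_lintegral_comp_fadingPathLoss hd hF_nonneg hF_integrable hF_mean
      (G := fun x => 1 - FadingNetwork.expNeg (FadingNetwork.extendTop g x))
      (measurable_const.sub (FadingNetwork.measurable_expNeg.comp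
        (FadingNetwork.measurable_extendTop hg))) (by simp)]
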